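/- Let $0\le s\le d$ be integers and let $\mathcal G(s,d)$ be the Grassmannian of all $s$-dimensional linear subspaces of Euclidean $\mathbb R^d$, with the quotient topology from the Stiefel manifold $\{P\in\mathbb R^{d\times s}: P^{\top}P=I_s\}$ under $P\mapsto \operatorname{range}(P)$. For $V,W\in\mathcal G(s,d)$ the principal angles $0\le\phi_1\le\dots\le\phi_s\le\frac{\pi}{2}$ and principal vectors $v_j\in V$, $w_j\in W$ are defined recursively for $j=1,\dots,s$ by $$\cos\phi_j=\max\{v^{\top}w:\ v\in V,\ w\in W,\ \|v\|=\|w\|=1,\ v^{\top}v_\ell=0=w^{\top}w_\ell\ (\ell<j)\}=v_j^{\top}w_j,$$ where $v_j,w_j$ are admissible in this maximum, and $\angle(V,W):=\phi_s$ is the maximal principal angle ($\angle(V,W):=0$ if $s=0$). Let $P_V$ denote the orthogonal projection onto $V$ and $\|\cdot\|$ the spectral norm. Then: 1. $\mathcal G(s,d)$ is compact, Hausdorff and second countable, and it is a smooth ($C^\infty$) manifold of dimension $s(d-s)$ with its standard charts: for $P\in\mathcal G(s,d)$, the chart around $P$ is defined on the set of subspaces complementary to $P^{\perp}$, and its inverse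 is $X\mapsto\{p+Xp: p\in P\}$, $X\in \mathrm{Hom}(P,P^{\perp})\cong\mathbb R^{s(d-s)}$. 2. For all $V,W\in\mathcal G(s,d)$ principal angles and vectors exist, and $\angle(V,W)$ does not depend on the choice of the principal vectors. 3. $d_1(V,W)=\angle(V,W)$ and $d_2(V,W)=\|P_V-P_W\|$ are metrics on $\mathcal G(s,d)$, and both induce its topology. 4. The two metrics are equivalent: for all $V,W\in\mathcal G(s,d)$, $$d_2(V,W)=\sin(\angle(V,W)),\qquad \tfrac{2}{\pi}\,\angle(V,W)\le d_2(V,W)\le\angle(V,W).$$ -/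

import Mathlib

open scoped Manifold ContDiff

/-- The Grassmannian of all `s`-dimensional linear subspaces of Euclidean `ℝ^d`. -/
def Grassmannian (s d : ℕ) : Type :=
  {V : Submodule ℝ (EuclideanSpace ℝ (Fin d)) // Module.finrank ℝ V = s}

/-- The Stiefel manifold: orthonormal `s`-frames in `ℝ^d`, i.e. the columns of the
`d × s` matrices `P` with `Pᵀ P = I`. It carries the subspace topology. -/
abbrev Stiefel (s d : ℕ) : Type :=
  {p : Fin s → EuclideanSpace ℝ (Fin d) // Orthonormal ℝ p}

/-- The map `P ↦ range P` from the Stiefel manifold to the Grassmannian. -/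
def Stiefel.span {s d : ℕ} (p : Stiefel s d) : Grassmannian s d :=
  ⟨Submodule.span ℝ (Set.range p.1), by
    rw [finrank_span_eq_card p.2.linearIndependent, Fintype.card_fin]⟩

/-- The standard topology of the Grassmannian: the quotient topology with respect to
the map from the Stiefel manifold. -/
instance Grassmannian.instTopologicalSpace (s d : ℕ) : TopologicalSpace (Grassmannian s d) :=
  TopologicalSpace.coinduced Stiefel.span inferInstance

/-- The graph `{p + X p | p ∈ P}` of a linear map `X : P → Pᗮ`. -/
noncomputable def graphSubspace {d : ℕ} (P : Submodule ℝ (EuclideanSpace ℝ (Fin d))) (X : P →ₗ[ℝ] Pᗮ) :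
    Submodule ℝ (EuclideanSpace ℝ (Fin d)) :=
  LinearMap.range (P.subtype + Pᗮ.subtype ∘ₗ X)

/-- `φ` is a standard (graph) chart of the Grassmannian around `P`: its domain consists of the
subspaces complementary to `Pᗮ`, and its inverse sends `x` to the graph of the linear map
`P → Pᗮ` that has coordinates `x` in some linear coordinate system `e` of `Hom(P, Pᗮ)`. -/
def IsGraphChart {s d : ℕ} (P : Grassmannian s d)
    (φ : OpenPartialHomeomorph (Grassmannian s d) (EuclideanSpace ℝ (Fin (s * (d - s))))) : Prop :=
  φ.source = {V | IsCompl V.1 (P.1)ᗮ} ∧ φ.target = Set.univ ∧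
    ∃ e : EuclideanSpace ℝ (Fin (s * (d - s))) ≃ₗ[ℝ] (P.1 →ₗ[ℝ] (P.1)ᗮ),
      ∀ x, (φ.symm x).1 = graphSubspace P.1 (e x)

/-- `φ` are principal angles between `V` and `W`, with principal vectors `v`, `w`
(recursive definition; the index `j : Fin s` stands for `j + 1`). -/
structure IsPrincipalSystem {s d : ℕ} (V W : Submodule ℝ (EuclideanSpace ℝ (Fin d)))
    (φ : Fin s → ℝ) (v w : Fin s → EuclideanSpace ℝ (Fin d)) : Prop where
  monotone : Monotone φ
  mem_Icc : ∀ j, φ j ∈ Set.Icc 0 (Real.pi / 2)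
  left_mem : ∀ j, v j ∈ V ∧ ‖v j‖ = 1 ∧ ∀ l < j, inner ℝ (v j) (v l) = 0
  right_mem : ∀ j, w j ∈ W ∧ ‖w j‖ = 1 ∧ ∀ l < j, inner ℝ (w j) (w l) = 0
  cos_eq : ∀ j, Real.cos (φ j) = inner ℝ (v j) (w j)
  isGreatest : ∀ j, IsGreatest
    {c : ℝ | ∃ x ∈ V, ∃ y ∈ W, ‖x‖ = 1 ∧ ‖y‖ = 1 ∧
      (∀ l < j, inner ℝ x (v l) = 0) ∧ (∀ l < j, inner ℝ y (w l) = 0) ∧ c = inner ℝ x y}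
    (Real.cos (φ j))

/-- The maximal principal angle: the unique value taken by the last principal angle of `V`
and `W` (and `0` if `s = 0`, where there are no principal angles). -/
noncomputable def maxAngle {s d : ℕ} (V W : Grassmannian s d) : ℝ :=
  sInf {θ : ℝ | ∃ (φ : Fin s → ℝ) (v w : Fin s → EuclideanSpace ℝ (Fin d)) (j : Fin s),
    IsPrincipalSystem V.1 W.1 φ v w ∧ (j : ℕ) + 1 = s ∧ θ = φ j}

/-- The spectral norm `‖P_V - P_W‖` of the difference of the orthogonal projections. -/
noncomputable def projDist {s d : ℕ} (V W : Grassmannian s d) : ℝ :=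
  ‖(V.1).starProjection - (W.1).starProjection‖

/-- `δ` is a metric on `X` that induces the given topology of `X`. -/
def IsCompatibleMetric {X : Type*} [t : TopologicalSpace X] (δ : X → X → ℝ) : Prop :=
  ∃ m : MetricSpace X, m.toPseudoMetricSpace.toUniformSpace.toTopologicalSpace = t ∧
    ∀ x y, m.dist x y = δ x y

/-!
Everything is controlled by the gap `‖P_V - P_W‖`.

*Principal angles.* Principal vectors exist because each maximum is taken over a nonempty compact
set. In any principal system `v i` and `w j` are orthogonal for `i ≠ j`, since otherwise turning
`v j` towards `v i` would increase `⟪v j, w j⟫` (`IsPrincipalSystem.inner_eq_zero_of_lt`). Hence the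
vectors `v i - cos (φ i) • w i` are orthogonal of length `sin (φ i)`, so every vector of `V` is
within `sin φ_s` times its length of `W`, and conversely. Two such one-sided bounds bound the gap
(`norm_starProjection_sub_le`), and `v_s` shows that the bound is attained. So the last angle of any
system is the arcsine of the gap (`maxAngle_eq_arcsin_projDist`), which gives that it is well defined
and the comparison of the two distances.

*Metrics.* The gap is the norm distance pulled back along `V ↦ P_V`. This map is continuous, since
`P_V = ∑ ⟪p i, ·⟫ p i` for an orthonormal frame `p` of `V`, and injective. The Grassmannian, an image
of the compact Stiefel manifold, is therefore embedded as a closed subset of the space of operators;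
this gives the topological claims and those on the gap. The triangle inequality for the maximal
angle comes from the one for angles between vectors (`norm_sub_starProjection_le_sin_add`).

*Charts.* If `L` is an operator into `ℝ^d` whose component in `P` is invertible, the range of `L` is
the graph of `L_{Pᗮ} ∘ (L_P)⁻¹`, which depends smoothly on `L` (`graphSubspace_graphCoord`,
`contDiffAt_graphCoord`). With `L` the restriction of `P_V` to `P` this shows that the graph chart is
continuous with open domain; with `L p = p + X p` on another subspace it shows that chart changes are
smooth. The inverse chart is continuous because the gap between two graphs is at most the distance
of the operators (`norm_starProjection_graphSubspace_sub_le`).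
-/

/-! ### The gap between two subspaces -/

section Gap

variable {E : Type*} [NormedAddCommGroup E] [InnerProductSpace ℝ E]

/-- The orthogonal projection of a vector `b ⊥ W` to `V` is small if `V` is close to `W`. -/
theorem norm_starProjection_le_of_mem_orthogonal {V W : Submodule ℝ E}
    [V.HasOrthogonalProjection] [W.HasOrthogonalProjection] {c : ℝ} (hc : 0 ≤ c)
    (hV : ∀ v ∈ V, ‖v - W.starProjection v‖ ≤ c * ‖v‖) {b : E} (hb : b ∈ Wᗮ) :
    ‖V.starProjection b‖ ≤ c * ‖b‖ := by
  set p := V.starProjection b with hp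
  have hpV : p ∈ V := V.starProjection_apply_mem b
  rcases eq_or_ne p 0 with h0 | h0
  · rw [h0, norm_zero]
    positivity
  have h1 : ‖p‖ * ‖p‖ = inner ℝ b (p - W.starProjection p) := by
    rw [inner_sub_right, (Submodule.mem_orthogonal' _ _).1 hb _ (W.starProjection_apply_mem p),
      sub_zero, ← real_inner_self_eq_norm_mul_norm]
    nth_rw 1 [hp]
    rw [Submodule.inner_starProjection_left_eq_right, V.starProjection_eq_self_iff.2 hpV]
  have h2 := (real_inner_le_norm b (p - W.starProjection p)).trans
    (mul_le_mul_of_nonneg_left (hV p hpV) (norm_nonneg b))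
  have h3 : 0 < ‖p‖ := norm_pos_iff.2 h0
  nlinarith

/-- If every vector of `V` is close to `W` and every vector of `W` is close to `V`, then the
orthogonal projections are close. Both hypotheses are needed unless the dimensions agree. -/
theorem norm_starProjection_sub_le {V W : Submodule ℝ E}
    [V.HasOrthogonalProjection] [W.HasOrthogonalProjection] {c : ℝ} (hc : 0 ≤ c)
    (hV : ∀ v ∈ V, ‖v - W.starProjection v‖ ≤ c * ‖v‖)
    (hW : ∀ w ∈ W, ‖w - V.starProjection w‖ ≤ c * ‖w‖) :
    ‖V.starProjection - W.starProjection‖ ≤ c := by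
  refine ContinuousLinearMap.opNorm_le_bound _ hc fun x => ?_
  set a := W.starProjection x with ha
  have haW : a ∈ W := W.starProjection_apply_mem x
  have hb : x - a ∈ Wᗮ := W.sub_starProjection_mem_orthogonal x
  have h1 := hW a haW
  have h2 : ‖V.starProjection (x - a)‖ ≤ c * ‖x - a‖ := by
    exact norm_starProjection_le_of_mem_orthogonal hc hV hb
  have hD : (V.starProjection - W.starProjection) x
      = V.starProjection (x - a) - (a - V.starProjection a) := by
    simp [ha]
  have horth : inner ℝ (V.starProjection (x - a)) (a - V.starProjection a) = 0 :=
    (Submodule.mem_orthogonal _ _).1 (V.sub_starProjection_mem_orthogonal a) _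
      (V.starProjection_apply_mem _)
  have hx : ‖x‖ * ‖x‖ = ‖a‖ * ‖a‖ + ‖x - a‖ * ‖x - a‖ := by
    have := norm_add_sq_eq_norm_sq_add_norm_sq_of_inner_eq_zero a (x - a)
      ((Submodule.mem_orthogonal _ _).1 hb _ haW)
    rwa [add_sub_cancel] at this
  have hDx := norm_sub_sq_eq_norm_sq_add_norm_sq_real horth
  rw [← hD] at hDx
  refine abs_le_of_sq_le_sq' ?_ (by positivity) |>.2
  rw [sq, hDx, mul_pow, sq ‖x‖, hx]
  nlinarith [mul_self_le_mul_self (norm_nonneg _) h1, mul_self_le_mul_self (norm_nonneg _) h2]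

theorem norm_sub_starProjection_le_norm_sub {V W : Submodule ℝ E}
    [V.HasOrthogonalProjection] [W.HasOrthogonalProjection] {v : E} (hv : v ∈ V) :
    ‖v - W.starProjection v‖ ≤ ‖V.starProjection - W.starProjection‖ * ‖v‖ := by
  simpa [V.starProjection_eq_self_iff.2 hv] using
    (V.starProjection - W.starProjection).le_opNorm v

theorem norm_sub_starProjection_le {W : Submodule ℝ E} [W.HasOrthogonalProjection] (x : E) {y : E}
    (hy : y ∈ W) : ‖x - W.starProjection x‖ ≤ ‖x - y‖ := by
  rw [W.starProjection_minimal x]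
  exact ciInf_le ⟨0, by rintro _ ⟨z, rfl⟩; exact norm_nonneg _⟩ (⟨y, hy⟩ : W)

/-- Pythagoras: the distance of `x` to `W` is at most `sin θ * ‖x‖` if and only if the projection
has length at least `cos θ * ‖x‖`. -/
theorem norm_sub_starProjection_le_sin_iff {W : Submodule ℝ E} [W.HasOrthogonalProjection] (x : E)
    {θ : ℝ} (h0 : 0 ≤ θ) (h1 : θ ≤ Real.pi / 2) :
    ‖x - W.starProjection x‖ ≤ Real.sin θ * ‖x‖ ↔ Real.cos θ * ‖x‖ ≤ ‖W.starProjection x‖ := by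
  have hs : 0 ≤ Real.sin θ := Real.sin_nonneg_of_nonneg_of_le_pi h0 (by linarith [Real.pi_pos])
  have hc : 0 ≤ Real.cos θ := Real.cos_nonneg_of_neg_pi_div_two_le_of_le (by linarith) h1
  have hx : ‖x‖ * ‖x‖ = ‖W.starProjection x‖ * ‖W.starProjection x‖
      + ‖x - W.starProjection x‖ * ‖x - W.starProjection x‖ := by
    have := norm_add_sq_eq_norm_sq_add_norm_sq_of_inner_eq_zero (W.starProjection x)
      (x - W.starProjection x) ((Submodule.mem_orthogonal _ _).1
        (W.sub_starProjection_mem_orthogonal x) _ (W.starProjection_apply_mem x))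
    rwa [add_sub_cancel] at this
  rw [← sq_le_sq₀ (norm_nonneg _) (by positivity), ← sq_le_sq₀ (by positivity) (norm_nonneg _),
    mul_pow, mul_pow, Real.sin_sq]
  constructor <;> intro h <;> nlinarith

/-- A vector close to `W` encloses a small angle with some vector of `W`, its projection. -/
theorem exists_mem_angle_le {W : Submodule ℝ E} [W.HasOrthogonalProjection] {x : E} (hx : x ≠ 0)
    {θ : ℝ} (h0 : 0 ≤ θ) (h1 : θ < Real.pi / 2)
    (h : ‖x - W.starProjection x‖ ≤ Real.sin θ * ‖x‖) :
    ∃ y ∈ W, y ≠ 0 ∧ InnerProductGeometry.angle x y ≤ θ := by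
  have hcos := (norm_sub_starProjection_le_sin_iff x h0 h1.le).1 h
  have hc : 0 < Real.cos θ := Real.cos_pos_of_mem_Ioo ⟨by linarith [Real.pi_pos], h1⟩
  have hx' : 0 < ‖x‖ := norm_pos_iff.2 hx
  have hp : 0 < ‖W.starProjection x‖ := lt_of_lt_of_le (by positivity) hcos
  refine ⟨W.starProjection x, W.starProjection_apply_mem x, norm_pos_iff.1 hp, ?_⟩
  rw [InnerProductGeometry.angle]
  have hi : inner ℝ x (W.starProjection x) = ‖W.starProjection x‖ * ‖W.starProjection x‖ := by
    rw [← real_inner_self_eq_norm_mul_norm, Submodule.inner_starProjection_left_eq_right,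
      W.starProjection_eq_self_iff.2 (W.starProjection_apply_mem x)]
  rw [hi, mul_div_mul_right _ _ hp.ne']
  calc Real.arccos (‖W.starProjection x‖ / ‖x‖) ≤ Real.arccos (Real.cos θ) :=
        Real.arccos_le_arccos ((le_div_iff₀ hx').2 hcos)
    _ = θ := Real.arccos_cos h0 (by linarith [Real.pi_pos])

/-- A vector that encloses a small angle with some vector of `W` is close to `W`. -/
theorem norm_sub_starProjection_le_of_angle_le {W : Submodule ℝ E} [W.HasOrthogonalProjection]
    {x y : E} (hy : y ∈ W) (hy0 : y ≠ 0) {θ : ℝ} (h1 : θ ≤ Real.pi / 2)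
    (h : InnerProductGeometry.angle x y ≤ θ) :
    ‖x - W.starProjection x‖ ≤ Real.sin θ * ‖x‖ := by
  have h0 : 0 ≤ θ := (InnerProductGeometry.angle_nonneg x y).trans h
  rw [norm_sub_starProjection_le_sin_iff x h0 h1]
  have hcos : Real.cos θ ≤ Real.cos (InnerProductGeometry.angle x y) :=
    Real.cos_le_cos_of_nonneg_of_le_pi (InnerProductGeometry.angle_nonneg x y)
      (by linarith [Real.pi_pos]) h
  have hi : Real.cos (InnerProductGeometry.angle x y) * (‖x‖ * ‖y‖) ≤
      ‖W.starProjection x‖ * ‖y‖ := by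
    rw [InnerProductGeometry.cos_angle_mul_norm_mul_norm]
    have := real_inner_le_norm (W.starProjection x) y
    rwa [Submodule.inner_starProjection_left_eq_right, W.starProjection_eq_self_iff.2 hy] at this
  have hy' : 0 < ‖y‖ := norm_pos_iff.2 hy0
  refine le_of_mul_le_mul_right (le_trans ?_ hi) hy'
  rw [mul_assoc]
  gcongr

/-- One half of the triangle inequality for the maximal angle: pass from `U` to `V` and from `V`
to `W`, each time by projecting, and use the triangle inequality for angles of vectors. -/
theorem norm_sub_starProjection_le_sin_add {V W : Submodule ℝ E}
    [V.HasOrthogonalProjection] [W.HasOrthogonalProjection] {α β : ℝ} (hα : 0 ≤ α) (hβ : 0 ≤ β)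
    (hαβ : α + β < Real.pi / 2) {x : E}
    (hx : ‖x - V.starProjection x‖ ≤ Real.sin α * ‖x‖)
    (hV : ∀ v ∈ V, ‖v - W.starProjection v‖ ≤ Real.sin β * ‖v‖) :
    ‖x - W.starProjection x‖ ≤ Real.sin (α + β) * ‖x‖ := by
  rcases eq_or_ne x 0 with rfl | hx0
  · simp
  obtain ⟨y, hyV, hy0, hy⟩ := exists_mem_angle_le hx0 hα (by linarith) hx
  obtain ⟨z, hzW, hz0, hz⟩ := exists_mem_angle_le hy0 hβ (by linarith) (hV y hyV)
  exact norm_sub_starProjection_le_of_angle_le hzW hz0 hαβ.le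
    ((InnerProductGeometry.angle_le_angle_add_angle x y z).trans (add_le_add hy hz))

theorem norm_starProjection_sub_le_one (V W : Submodule ℝ E)
    [V.HasOrthogonalProjection] [W.HasOrthogonalProjection] :
    ‖V.starProjection - W.starProjection‖ ≤ 1 := by
  have aux (U : Submodule ℝ E) [U.HasOrthogonalProjection] (x : E) :
      ‖x - U.starProjection x‖ ≤ 1 * ‖x‖ := by
    simpa using norm_sub_starProjection_le x (W := U) U.zero_mem
  exact norm_starProjection_sub_le zero_le_one (fun v _ => aux W v) (fun w _ => aux V w)

theorem arcsin_norm_starProjection_sub_triangle (U V W : Submodule ℝ E)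
    [U.HasOrthogonalProjection] [V.HasOrthogonalProjection] [W.HasOrthogonalProjection] :
    Real.arcsin ‖U.starProjection - W.starProjection‖ ≤
      Real.arcsin ‖U.starProjection - V.starProjection‖ +
      Real.arcsin ‖V.starProjection - W.starProjection‖ := by
  have key (A B : Submodule ℝ E) [A.HasOrthogonalProjection] [B.HasOrthogonalProjection] :
      Real.sin (Real.arcsin ‖A.starProjection - B.starProjection‖) =
        ‖A.starProjection - B.starProjection‖ :=
    Real.sin_arcsin (by linarith [norm_nonneg (A.starProjection - B.starProjection)])
      (norm_starProjection_sub_le_one A B)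
  have hUV := key U V
  have hVW := key V W
  set α := Real.arcsin ‖U.starProjection - V.starProjection‖
  set β := Real.arcsin ‖V.starProjection - W.starProjection‖
  have hα0 : 0 ≤ α := Real.arcsin_nonneg.2 (norm_nonneg _)
  have hβ0 : 0 ≤ β := Real.arcsin_nonneg.2 (norm_nonneg _)
  rcases le_or_gt (Real.pi / 2) (α + β) with h | h
  · exact (Real.arcsin_le_pi_div_two _).trans h
  refine (Real.arcsin_le_iff_le_sin' ⟨by linarith [Real.pi_pos], h⟩).2
    (norm_starProjection_sub_le
      (Real.sin_nonneg_of_nonneg_of_le_pi (by linarith) (by linarith [Real.pi_pos])) ?_ ?_)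
  · intro u hu
    refine norm_sub_starProjection_le_sin_add (V := V) hα0 hβ0 h ?_ fun v hv => ?_
    · rw [hUV]
      exact norm_sub_starProjection_le_norm_sub (V := U) (W := V) hu
    · rw [hVW]
      exact norm_sub_starProjection_le_norm_sub (V := V) (W := W) hv
  · intro w hw
    rw [add_comm α β]
    refine norm_sub_starProjection_le_sin_add (V := V) hβ0 hα0 (by linarith) ?_ fun v hv => ?_
    · rw [hVW, norm_sub_rev V.starProjection]
      exact norm_sub_starProjection_le_norm_sub (V := W) (W := V) hw
    · rw [hUV, norm_sub_rev U.starProjection]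
      exact norm_sub_starProjection_le_norm_sub (V := V) (W := U) hv

end Gap

/-! ### Principal angles and vectors -/

section PrincipalAngles

namespace IsPrincipalSystem

variable {s d : ℕ} {V W : Submodule ℝ (EuclideanSpace ℝ (Fin d))}
  {φ : Fin s → ℝ} {v w : Fin s → EuclideanSpace ℝ (Fin d)}

theorem symm (h : IsPrincipalSystem V W φ v w) : IsPrincipalSystem W V φ w v where
  monotone := h.monotone
  mem_Icc := h.mem_Icc
  left_mem := h.right_mem
  right_mem := h.left_mem
  cos_eq j := by rw [h.cos_eq, real_inner_comm]
  isGreatest j := by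
    convert h.isGreatest j using 1
    ext c
    constructor
    · rintro ⟨x, hx, y, hy, hx1, hy1, hxl, hyl, rfl⟩
      exact ⟨y, hy, x, hx, hy1, hx1, hyl, hxl, real_inner_comm _ _⟩
    · rintro ⟨x, hx, y, hy, hx1, hy1, hxl, hyl, rfl⟩
      exact ⟨y, hy, x, hx, hy1, hx1, hyl, hxl, real_inner_comm _ _⟩

theorem orthonormal_left (h : IsPrincipalSystem V W φ v w) : Orthonormal ℝ v := by
  refine ⟨fun j => (h.left_mem j).2.1, fun i j hij => ?_⟩
  rcases lt_or_gt_of_ne hij with hlt | hlt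
  · rw [real_inner_comm]
    exact (h.left_mem j).2.2 i hlt
  · exact (h.left_mem i).2.2 j hlt

/-- Principal vectors with different indices are orthogonal: if `⟪v i, w j⟫ ≠ 0` with `j < i`,
turning `v j` towards `v i` would increase the inner product with `w j`. -/
theorem inner_eq_zero_of_lt (h : IsPrincipalSystem V W φ v w) {i j : Fin s} (hji : j < i) :
    inner ℝ (v i) (w j) = 0 := by
  set b := inner ℝ (v i) (w j) with hb
  set a := Real.cos (φ j) with ha
  have ho := h.orthonormal_left
  -- the competitor of `v j` is the normalization of `v j + t • v i`
  have key : ∀ t : ℝ, a + t * b ≤ Real.sqrt (1 + t ^ 2) * a := by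
    intro t
    have hr : 0 < Real.sqrt (1 + t ^ 2) := Real.sqrt_pos.2 (by positivity)
    have hn : ‖v j + t • v i‖ = Real.sqrt (1 + t ^ 2) := by
      rw [eq_comm, Real.sqrt_eq_iff_mul_self_eq (by positivity) (norm_nonneg _),
        norm_add_sq_eq_norm_sq_add_norm_sq_of_inner_eq_zero _ _
          (by rw [real_inner_smul_right, ho.2 hji.ne, mul_zero]), norm_smul, ho.1, ho.1,
        Real.norm_eq_abs]
      nlinarith [abs_mul_abs_self t]
    have := (h.isGreatest j).2 ⟨(Real.sqrt (1 + t ^ 2))⁻¹ • (v j + t • v i),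
      V.smul_mem _ (V.add_mem (h.left_mem j).1 (V.smul_mem _ (h.left_mem i).1)), w j,
      (h.right_mem j).1, by rw [norm_smul, hn, norm_inv, Real.norm_of_nonneg hr.le,
        inv_mul_cancel₀ hr.ne'], (h.right_mem j).2.1, ?_, (h.right_mem j).2.2, rfl⟩
    · rw [real_inner_smul_left, inner_add_left, real_inner_smul_left, ← h.cos_eq,
        inv_mul_le_iff₀ hr] at this
      exact this
    · intro l hl
      rw [real_inner_smul_left, inner_add_left, real_inner_smul_left, ho.2 hl.ne',
        ho.2 (hl.trans hji).ne', mul_zero, add_zero, mul_zero]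
  have ha0 : 0 ≤ a := Real.cos_nonneg_of_neg_pi_div_two_le_of_le
    (by linarith [(h.mem_Icc j).1, Real.pi_pos]) (h.mem_Icc j).2
  have ha1 : a ≤ 1 := Real.cos_le_one _
  have hsq : Real.sqrt (1 + b ^ 2) ≤ 1 + b ^ 2 / 2 := by
    rw [Real.sqrt_le_left (by positivity)]
    nlinarith [sq_nonneg (b ^ 2)]
  -- with `t = b` the gain `b ^ 2` is twice the largest possible growth of the norm
  have := key b
  have h2 : Real.sqrt (1 + b ^ 2) * a ≤ (1 + b ^ 2 / 2) * a := by gcongr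
  have h3 : b ^ 2 ≤ 0 := by nlinarith [sq_nonneg b]
  exact pow_eq_zero_iff two_ne_zero |>.1 (le_antisymm h3 (sq_nonneg b))

theorem inner_eq (h : IsPrincipalSystem V W φ v w) (i j : Fin s) :
    inner ℝ (v i) (w j) = if i = j then Real.cos (φ i) else 0 := by
  rcases lt_trichotomy i j with hij | rfl | hij
  · rw [if_neg hij.ne, real_inner_comm]
    exact h.symm.inner_eq_zero_of_lt hij
  · rw [if_pos rfl, h.cos_eq]
  · rw [if_neg hij.ne', h.inner_eq_zero_of_lt hij]

/-- The vectors `v i - cos (φ i) • w i` are pairwise orthogonal, of length `sin (φ i)`. -/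
theorem inner_sub_sub (h : IsPrincipalSystem V W φ v w) (i j : Fin s) :
    inner ℝ (v i - Real.cos (φ i) • w i) (v j - Real.cos (φ j) • w j) =
      if i = j then Real.sin (φ i) ^ 2 else 0 := by
  have hv := orthonormal_iff_ite.1 h.orthonormal_left i j
  have hw := orthonormal_iff_ite.1 h.symm.orthonormal_left i j
  have h1 := h.inner_eq i j
  have h2 := h.symm.inner_eq i j
  simp only [inner_sub_left, inner_sub_right, real_inner_smul_left, real_inner_smul_right, hv, hw,
    h1, h2]
  split_ifs with hij
  · subst hij
    rw [Real.sin_sq]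
    ring
  · ring

theorem span_left (h : IsPrincipalSystem V W φ v w) (hV : Module.finrank ℝ V = s) :
    Submodule.span ℝ (Set.range v) = V := by
  refine Submodule.eq_of_le_of_finrank_eq (Submodule.span_le.2 ?_) ?_
  · rintro _ ⟨j, rfl⟩
    exact (h.left_mem j).1
  · rw [finrank_span_eq_card h.orthonormal_left.linearIndependent, Fintype.card_fin, hV]

/-- `W` contains `∑ a i • cos (φ i) • w i`, which is at distance at most `sin (φ k) * ‖x‖` from
`x = ∑ a i • v i`. -/
theorem norm_sub_starProjection_le (h : IsPrincipalSystem V W φ v w)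
    (hV : Module.finrank ℝ V = s) {k : Fin s} (hk : ∀ i, i ≤ k)
    {x : EuclideanSpace ℝ (Fin d)} (hx : x ∈ V) :
    ‖x - W.starProjection x‖ ≤ Real.sin (φ k) * ‖x‖ := by
  rw [← h.span_left hV, Submodule.mem_span_range_iff_exists_fun] at hx
  obtain ⟨a, rfl⟩ := hx
  have hs (i) : 0 ≤ Real.sin (φ i) := Real.sin_nonneg_of_nonneg_of_le_pi (h.mem_Icc i).1
    (by linarith [(h.mem_Icc i).2, Real.pi_pos])
  have hsk (i) : Real.sin (φ i) ≤ Real.sin (φ k) := Real.sin_le_sin_of_le_of_le_pi_div_two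
    (by linarith [(h.mem_Icc i).1, Real.pi_pos]) (h.mem_Icc k).2 (h.monotone (hk i))
  refine (_root_.norm_sub_starProjection_le _ (y := ∑ i, a i • Real.cos (φ i) • w i)
    (W.sum_mem fun i _ => W.smul_mem _ (W.smul_mem _ (h.right_mem i).1))).trans ?_
  rw [← Finset.sum_sub_distrib, ← sq_le_sq₀ (norm_nonneg _)
    (mul_nonneg (hs k) (norm_nonneg _)), mul_pow]
  simp only [← smul_sub]
  rw [← real_inner_self_eq_norm_sq, ← real_inner_self_eq_norm_sq,
    h.orthonormal_left.inner_sum]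
  simp only [sum_inner, inner_sum, real_inner_smul_left, real_inner_smul_right, h.inner_sub_sub,
    mul_ite, mul_zero, Finset.sum_ite_eq', Finset.mem_univ, if_true]
  rw [Finset.mul_sum]
  refine Finset.sum_le_sum fun i _ => ?_
  have : Real.sin (φ i) ^ 2 ≤ Real.sin (φ k) ^ 2 := pow_le_pow_left₀ (hs i) (hsk i) 2
  simp only [conj_trivial]
  nlinarith [mul_self_nonneg (a i)]

theorem starProjection_left (h : IsPrincipalSystem V W φ v w) (hW : Module.finrank ℝ W = s)
    (k : Fin s) : W.starProjection (v k) = Real.cos (φ k) • w k := by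
  refine W.eq_starProjection_of_mem_of_inner_eq_zero (W.smul_mem _ (h.right_mem k).1) ?_
  intro y hy
  rw [← h.symm.span_left hW, Submodule.mem_span_range_iff_exists_fun] at hy
  obtain ⟨a, rfl⟩ := hy
  rw [inner_sum]
  refine Finset.sum_eq_zero fun i _ => ?_
  rw [real_inner_smul_right, inner_sub_left, real_inner_smul_left, h.inner_eq,
    orthonormal_iff_ite.1 h.symm.orthonormal_left]
  split_ifs <;> simp

/-- The gap of two subspaces of equal dimension is the sine of the last principal angle. -/
theorem norm_starProjection_sub (h : IsPrincipalSystem V W φ v w)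
    (hV : Module.finrank ℝ V = s) (hW : Module.finrank ℝ W = s) {k : Fin s} (hk : ∀ i, i ≤ k) :
    ‖V.starProjection - W.starProjection‖ = Real.sin (φ k) := by
  have hs : 0 ≤ Real.sin (φ k) := Real.sin_nonneg_of_nonneg_of_le_pi (h.mem_Icc k).1
    (by linarith [(h.mem_Icc k).2, Real.pi_pos])
  refine le_antisymm (norm_starProjection_sub_le hs
    (fun x hx => h.norm_sub_starProjection_le hV hk hx)
    (fun x hx => h.symm.norm_sub_starProjection_le hW hk hx)) ?_
  have h1 := norm_sub_starProjection_le_norm_sub (V := V) (W := W) (h.left_mem k).1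
  rw [(h.left_mem k).2.1, mul_one, h.starProjection_left hW] at h1
  refine le_trans (le_of_eq ?_) h1
  rw [eq_comm, ← sq_eq_sq₀ (norm_nonneg _) hs, ← real_inner_self_eq_norm_sq, h.inner_sub_sub,
    if_pos rfl]

theorem eq_arcsin (h : IsPrincipalSystem V W φ v w)
    (hV : Module.finrank ℝ V = s) (hW : Module.finrank ℝ W = s) {k : Fin s} (hk : ∀ i, i ≤ k) :
    φ k = Real.arcsin ‖V.starProjection - W.starProjection‖ := by
  rw [h.norm_starProjection_sub hV hW hk, Real.arcsin_sin
    (by linarith [(h.mem_Icc k).1, Real.pi_pos]) (h.mem_Icc k).2]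

end IsPrincipalSystem

/-- Once `n < s` pairs of principal vectors have been chosen, the maximum that defines the next
pair is attained. -/
theorem exists_isGreatest_inner {s d : ℕ} {V W : Submodule ℝ (EuclideanSpace ℝ (Fin d))}
    (hV : Module.finrank ℝ V = s) (hW : Module.finrank ℝ W = s)
    (v w : ℕ → EuclideanSpace ℝ (Fin d)) {n : ℕ} (hn : n < s) :
    ∃ x ∈ V, ∃ y ∈ W, ‖x‖ = 1 ∧ ‖y‖ = 1 ∧ (∀ l < n, inner ℝ x (v l) = 0) ∧
      (∀ l < n, inner ℝ y (w l) = 0) ∧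
      ∀ x' ∈ V, ∀ y' ∈ W, ‖x'‖ = 1 → ‖y'‖ = 1 → (∀ l < n, inner ℝ x' (v l) = 0) →
        (∀ l < n, inner ℝ y' (w l) = 0) → inner ℝ x' y' ≤ inner ℝ x y := by
  -- unit vectors of `V` orthogonal to fewer than `dim V` given vectors
  let S (V : Submodule ℝ (EuclideanSpace ℝ (Fin d))) (v : ℕ → EuclideanSpace ℝ (Fin d)) :
    Set (EuclideanSpace ℝ (Fin d)) := {x | x ∈ V ∧ ‖x‖ = 1 ∧ ∀ l < n, inner ℝ x (v l) = 0}
  have hcomp (V : Submodule ℝ (EuclideanSpace ℝ (Fin d))) (v) : IsCompact (S V v) := by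
    refine (isCompact_sphere (0 : EuclideanSpace ℝ (Fin d)) 1).of_isClosed_subset ?_ ?_
    · have : S V v = (V : Set (EuclideanSpace ℝ (Fin d))) ∩ ({x | ‖x‖ = 1} ∩
          ⋂ l, ⋂ (_ : l < n), {x | inner ℝ x (v l) = 0}) := by
        ext x
        simp [S]
      rw [this]
      refine V.closed_of_finiteDimensional.inter
        ((isClosed_eq continuous_norm continuous_const).inter
          (isClosed_iInter fun l => isClosed_iInter fun _ =>
            isClosed_eq (by fun_prop) (by fun_prop)))
    · intro x hx
      simpa using hx.2.1
  have hne (V : Submodule ℝ (EuclideanSpace ℝ (Fin d))) (v) (hV : Module.finrank ℝ V = s) :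
      (S V v).Nonempty := by
    let f : V →ₗ[ℝ] (Fin n → ℝ) :=
      LinearMap.pi fun l => (innerₛₗ ℝ (v l)) ∘ₗ V.subtype
    have hker : LinearMap.ker f ≠ ⊥ := LinearMap.ker_ne_bot_of_finrank_lt (by simpa [hV] using hn)
    obtain ⟨x, hx, hx0⟩ := Submodule.exists_mem_ne_zero_of_ne_bot hker
    have hx0' : ‖(x : EuclideanSpace ℝ (Fin d))‖ ≠ 0 := by simpa using hx0
    refine ⟨‖(x : EuclideanSpace ℝ (Fin d))‖⁻¹ • (x : EuclideanSpace ℝ (Fin d)),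
      V.smul_mem _ x.2, ?_, ?_⟩
    · rw [norm_smul, norm_inv, norm_norm, inv_mul_cancel₀ hx0']
    · intro l hl
      have := congrFun (LinearMap.mem_ker.1 hx) ⟨l, hl⟩
      rw [real_inner_smul_left, real_inner_comm]
      rw [show inner ℝ (v l) (x : EuclideanSpace ℝ (Fin d)) = 0 from this, mul_zero]
  obtain ⟨⟨x, y⟩, ⟨hx, hy⟩, hmax⟩ := ((hcomp V v).prod (hcomp W w)).exists_isMaxOn
    ((hne V v hV).prod (hne W w hW)) (f := fun p => (inner ℝ p.1 p.2 : ℝ))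
    (by fun_prop)
  exact ⟨x, hx.1, y, hy.1, hx.2.1, hy.2.1, hx.2.2, hy.2.2,
    fun x' hx' y' hy' h1 h2 h3 h4 => hmax (a := (x', y')) ⟨⟨hx', h1, h3⟩, ⟨hy', h2, h4⟩⟩⟩

/-- Principal vectors can be chosen recursively, by compactness of the unit spheres. -/
theorem exists_principal_vectors {s d : ℕ} {V W : Submodule ℝ (EuclideanSpace ℝ (Fin d))}
    (hV : Module.finrank ℝ V = s) (hW : Module.finrank ℝ W = s) (k : ℕ) (hk : k ≤ s) :
    ∃ v w : ℕ → EuclideanSpace ℝ (Fin d), ∀ n < k,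
      v n ∈ V ∧ w n ∈ W ∧ ‖v n‖ = 1 ∧ ‖w n‖ = 1 ∧ (∀ l < n, inner ℝ (v n) (v l) = 0) ∧
      (∀ l < n, inner ℝ (w n) (w l) = 0) ∧
      ∀ x' ∈ V, ∀ y' ∈ W, ‖x'‖ = 1 → ‖y'‖ = 1 → (∀ l < n, inner ℝ x' (v l) = 0) →
        (∀ l < n, inner ℝ y' (w l) = 0) → inner ℝ x' y' ≤ inner ℝ (v n) (w n) := by
  induction k with
  | zero => exact ⟨0, 0, fun n hn => absurd hn n.not_lt_zero⟩
  | succ k ih =>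
    obtain ⟨v, w, h⟩ := ih (by omega)
    obtain ⟨x, hx, y, hy, H⟩ := exists_isGreatest_inner hV hW v w (n := k) (by omega)
    have hup (u : ℕ → EuclideanSpace ℝ (Fin d)) (z) {l : ℕ} (hl : l < k) :
      Function.update u k z l = u l := Function.update_of_ne hl.ne _ _
    refine ⟨Function.update v k x, Function.update w k y, fun n hn => ?_⟩
    have hlt : ∀ l < n, l < k := fun l hl => by omega
    have hforall (x' : EuclideanSpace ℝ (Fin d)) (u : ℕ → EuclideanSpace ℝ (Fin d)) (z) :
        (∀ l < n, inner ℝ x' (Function.update u k z l) = 0) ↔ ∀ l < n, inner ℝ x' (u l) = 0 :=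
      forall₂_congr fun l hl => by rw [hup u z (hlt l hl)]
    simp only [hforall]
    rcases Nat.lt_succ_iff_lt_or_eq.1 hn with hn' | rfl
    · simp only [hup _ _ hn']
      exact h n hn'
    · simp only [Function.update_self]
      exact ⟨hx, hy, H⟩

theorem exists_isPrincipalSystem {s d : ℕ} {V W : Submodule ℝ (EuclideanSpace ℝ (Fin d))}
    (hV : Module.finrank ℝ V = s) (hW : Module.finrank ℝ W = s) :
    ∃ (φ : Fin s → ℝ) (v w : Fin s → EuclideanSpace ℝ (Fin d)), IsPrincipalSystem V W φ v w := by
  obtain ⟨v, w, h⟩ := exists_principal_vectors hV hW s le_rfl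
  -- replacing `w n` by `-w n` in the maximality shows that the maxima are nonnegative
  have hnonneg (n) (hn : n < s) : 0 ≤ inner ℝ (v n) (w n) := by
    obtain ⟨h1, h2, h3, h4, h5, h6, h7⟩ := h n hn
    have := h7 (v n) h1 (-w n) (W.neg_mem h2) h3 (by rwa [norm_neg]) h5
      (fun l hl => by rw [inner_neg_left, h6 l hl, neg_zero])
    rw [inner_neg_right] at this
    linarith
  have hle (n) (hn : n < s) : inner ℝ (v n) (w n) ≤ 1 := by
    obtain ⟨-, -, h3, h4, -⟩ := h n hn
    simpa [h3, h4] using real_inner_le_norm (v n) (w n)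
  have hcos (j : Fin s) : Real.cos (Real.arccos (inner ℝ (v j) (w j))) = inner ℝ (v j) (w j) :=
    Real.cos_arccos (by linarith [hnonneg j j.2]) (hle j j.2)
  have hlt (j : Fin s) (x : EuclideanSpace ℝ (Fin d)) (u : ℕ → EuclideanSpace ℝ (Fin d)) :
      (∀ l < j, inner ℝ x (u l) = 0) ↔ ∀ l < (j : ℕ), inner ℝ x (u l) = 0 :=
    ⟨fun H l hl => H ⟨l, hl.trans j.2⟩ hl, fun H l hl => H l hl⟩
  refine ⟨fun j => Real.arccos (inner ℝ (v j) (w j)), fun j => v j, fun j => w j, ?_⟩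
  constructor
  · intro i j hij
    obtain ⟨h1, h2, h3, h4, h5, h6, h7⟩ := h j j.2
    have hij' : (i : ℕ) ≤ j := hij
    exact Real.arccos_le_arccos ((h i i.2).2.2.2.2.2.2 _ h1 _ h2 h3 h4
      (fun l hl => h5 l (by omega)) (fun l hl => h6 l (by omega)))
  · exact fun j => ⟨Real.arccos_nonneg _, Real.arccos_le_pi_div_two.2 (hnonneg j j.2)⟩
  · intro j
    rw [hlt j (v j) v]
    exact ⟨(h j j.2).1, (h j j.2).2.2.1, (h j j.2).2.2.2.2.1⟩
  · intro j
    rw [hlt j (w j) w]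
    exact ⟨(h j j.2).2.1, (h j j.2).2.2.2.1, (h j j.2).2.2.2.2.2.1⟩
  · exact hcos
  · intro j
    obtain ⟨h1, h2, h3, h4, h5, h6, h7⟩ := h j j.2
    rw [hcos j]
    simp only [hlt _ _ v, hlt _ _ w]
    refine ⟨⟨v j, h1, w j, h2, h3, h4, h5, h6, rfl⟩, ?_⟩
    rintro _ ⟨x, hx, y, hy, hx1, hy1, hxl, hyl, rfl⟩
    exact h7 x hx y hy hx1 hy1 hxl hyl

/-- The last principal angle, expressed by the gap. For `s = 0` both sides vanish. -/
theorem maxAngle_eq_arcsin_projDist {s d : ℕ} (V W : Grassmannian s d) :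
    maxAngle V W = Real.arcsin (projDist V W) := by
  rcases Nat.eq_zero_or_pos s with rfl | hs
  · have h : V = W := Subtype.ext <| by
      rw [Submodule.finrank_eq_zero.1 V.2, Submodule.finrank_eq_zero.1 W.2]
    subst h
    have : {θ : ℝ | ∃ (φ : Fin 0 → ℝ) (v w : Fin 0 → EuclideanSpace ℝ (Fin d)) (j : Fin 0),
        IsPrincipalSystem V.1 V.1 φ v w ∧ (j : ℕ) + 1 = 0 ∧ θ = φ j} = ∅ :=
      Set.eq_empty_of_forall_notMem fun θ ⟨_, _, _, j, _⟩ => j.elim0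
    rw [maxAngle, this, Real.sInf_empty, projDist, sub_self, norm_zero, Real.arcsin_zero]
  · have : {θ : ℝ | ∃ (φ : Fin s → ℝ) (v w : Fin s → EuclideanSpace ℝ (Fin d)) (j : Fin s),
        IsPrincipalSystem V.1 W.1 φ v w ∧ (j : ℕ) + 1 = s ∧ θ = φ j} =
          {Real.arcsin (projDist V W)} := by
      ext θ
      constructor
      · rintro ⟨φ, v, w, j, h, hj, rfl⟩
        exact h.eq_arcsin V.2 W.2 fun i => Fin.le_def.2 (by omega)
      · rintro rfl
        obtain ⟨φ, v, w, h⟩ := exists_isPrincipalSystem V.2 W.2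
        refine ⟨φ, v, w, ⟨s - 1, by omega⟩, h, Nat.sub_add_cancel hs, ?_⟩
        exact (h.eq_arcsin V.2 W.2 fun i => Fin.le_def.2 (Nat.le_sub_one_of_lt i.2)).symm
    rw [maxAngle, this, csInf_singleton]

end PrincipalAngles

/-! ### Topology and metrics -/

section Topology

/-- A symmetric function that satisfies the triangle inequality and is bounded above and below by
multiples of a compatible metric is a compatible metric. -/
theorem IsCompatibleMetric.of_le_mul {X : Type*} [TopologicalSpace X] {δ δ' : X → X → ℝ}
    (h : IsCompatibleMetric δ) (hcomm : ∀ x y, δ' x y = δ' y x)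
    (htri : ∀ x y z, δ' x z ≤ δ' x y + δ' y z) {a b : ℝ} (ha : 0 < a) (hb : 0 < b)
    (h1 : ∀ x y, δ x y ≤ a * δ' x y) (h2 : ∀ x y, δ' x y ≤ b * δ x y) :
    IsCompatibleMetric δ' := by
  obtain ⟨m, rfl, hd⟩ := h
  have hself (x : X) : δ' x x = 0 := by
    have e1 := h1 x x
    have e2 := h2 x x
    rw [← hd, dist_self] at e1 e2
    exact le_antisymm (by simpa using e2) (by nlinarith)
  let m' : MetricSpace X :=
    { dist := δ'
      dist_self := hself
      dist_comm := hcomm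
      dist_triangle := htri
      eq_of_dist_eq_zero := fun {x y} hxy => by
        have e1 := h1 x y
        rw [show δ' x y = 0 from hxy, mul_zero, ← hd] at e1
        exact dist_le_zero.1 e1 }
  refine ⟨m', le_antisymm ?_ ?_, fun _ _ => rfl⟩
  · rw [← continuous_id_iff_le]
    refine (@Metric.continuous_iff X X m'.toPseudoMetricSpace m.toPseudoMetricSpace id).2
      fun x ε hε => ⟨ε / a, div_pos hε ha, fun y hy => ?_⟩
    have hy' : δ' y x < ε / a := hy
    rw [lt_div_iff₀' ha] at hy'
    exact (hd y x).trans_lt ((h1 y x).trans_lt hy')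
  · rw [← continuous_id_iff_le]
    refine (@Metric.continuous_iff X X m.toPseudoMetricSpace m'.toPseudoMetricSpace id).2
      fun x ε hε => ⟨ε / b, div_pos hε hb, fun y hy => ?_⟩
    rw [hd, lt_div_iff₀' hb] at hy
    exact (h2 y x).trans_lt hy

instance Stiefel.instCompactSpace (s d : ℕ) : CompactSpace (Stiefel s d) := by
  refine isCompact_iff_compactSpace.1 ((isCompact_univ_pi fun _ : Fin s =>
    isCompact_sphere (0 : EuclideanSpace ℝ (Fin d)) 1).of_isClosed_subset ?_ ?_)
  · have : {p : Fin s → EuclideanSpace ℝ (Fin d) | Orthonormal ℝ p} =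
        ⋂ i, ⋂ j, {p | inner ℝ (p i) (p j) = if i = j then (1 : ℝ) else 0} := by
      ext p
      simp [orthonormal_iff_ite]
    change IsClosed {p : Fin s → EuclideanSpace ℝ (Fin d) | Orthonormal ℝ p}
    rw [this]
    exact isClosed_iInter fun i => isClosed_iInter fun j =>
      isClosed_eq (by fun_prop) continuous_const
  · intro p hp i _
    simpa using hp.1 i

theorem Stiefel.span_surjective (s d : ℕ) :
    Function.Surjective (Stiefel.span : Stiefel s d → Grassmannian s d) := by
  intro V
  let b := (stdOrthonormalBasis ℝ V.1).reindex (finCongr V.2)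
  have hb : Orthonormal ℝ fun i => (b i : EuclideanSpace ℝ (Fin d)) :=
    b.orthonormal.comp_linearIsometry V.1.subtypeₗᵢ
  refine ⟨⟨fun i => b i, hb⟩, Subtype.ext ?_⟩
  refine Submodule.eq_of_le_of_finrank_eq (Submodule.span_le.2 ?_) ?_
  · rintro _ ⟨i, rfl⟩
    exact (b i).2
  · exact (Stiefel.span ⟨_, hb⟩).2.trans V.2.symm

theorem Stiefel.continuous_span (s d : ℕ) :
    Continuous (Stiefel.span : Stiefel s d → Grassmannian s d) :=
  continuous_coinduced_rng

theorem Stiefel.starProjection_span {s d : ℕ} (p : Stiefel s d) :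
    p.span.1.starProjection = ∑ i, InnerProductSpace.rankOne ℝ (p.1 i) (p.1 i) := by
  ext1 x
  have hmem (i) : p.1 i ∈ p.span.1 := Submodule.subset_span ⟨i, rfl⟩
  refine p.span.1.eq_starProjection_of_mem_of_inner_eq_zero ?_ ?_
  · simp only [sum_apply, InnerProductSpace.rankOne_apply]
    exact p.span.1.sum_mem fun i _ => p.span.1.smul_mem _ (hmem i)
  · intro y hy
    obtain ⟨a, rfl⟩ := (Submodule.mem_span_range_iff_exists_fun ℝ).1 hy
    rw [inner_sum]
    refine Finset.sum_eq_zero fun i _ => ?_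
    simp [inner_sub_left, sum_inner, real_inner_smul_right, orthonormal_iff_ite.1 p.2,
      real_inner_comm, mul_comm]

namespace Grassmannian

variable {s d : ℕ}

/-- The embedding of the Grassmannian into the operators on `ℝ^d` that sends a subspace to its
orthogonal projection. -/
noncomputable def toProjection (V : Grassmannian s d) :
    EuclideanSpace ℝ (Fin d) →L[ℝ] EuclideanSpace ℝ (Fin d) :=
  V.1.starProjection

theorem continuous_toProjection : Continuous (toProjection : Grassmannian s d → _) := by
  refine continuous_coinduced_dom.2 ?_
  have : toProjection ∘ Stiefel.span = fun p : Stiefel s d =>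
      ∑ i, InnerProductSpace.rankOne ℝ (p.1 i) (p.1 i) :=
    funext Stiefel.starProjection_span
  rw [this]
  refine continuous_finsetSum _ fun i _ => ?_
  have hi : Continuous fun p : Stiefel s d => p.1 i :=
    (continuous_apply i).comp continuous_subtype_val
  exact ((InnerProductSpace.rankOne ℝ).continuous.comp hi).clm_apply hi

theorem toProjection_injective : Function.Injective (toProjection : Grassmannian s d → _) :=
  fun _ _ h => Subtype.ext (Submodule.starProjection_inj.1 h)

instance : CompactSpace (Grassmannian s d) :=
  (Stiefel.span_surjective s d).compactSpace (Stiefel.continuous_span s d)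

/-- A continuous injection of a compact space into a Hausdorff space is a closed embedding. -/
theorem isClosedEmbedding_toProjection :
    Topology.IsClosedEmbedding (toProjection : Grassmannian s d → _) :=
  continuous_toProjection.isClosedEmbedding toProjection_injective

instance : T2Space (Grassmannian s d) :=
  isClosedEmbedding_toProjection.isEmbedding.t2Space

instance : SecondCountableTopology (Grassmannian s d) :=
  isClosedEmbedding_toProjection.isEmbedding.secondCountableTopology

theorem isCompatibleMetric_projDist :
    IsCompatibleMetric (projDist : Grassmannian s d → Grassmannian s d → ℝ) :=
  ⟨MetricSpace.induced toProjection toProjection_injective inferInstance,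
    isClosedEmbedding_toProjection.isEmbedding.eq_induced.symm,
    fun V W => dist_eq_norm V.toProjection W.toProjection⟩

end Grassmannian

variable {s d : ℕ} (V W : Grassmannian s d)

theorem projDist_nonneg : 0 ≤ projDist V W := norm_nonneg _

theorem projDist_le_one : projDist V W ≤ 1 := norm_starProjection_sub_le_one _ _

theorem projDist_comm : projDist V W = projDist W V := norm_sub_rev _ _

theorem projDist_eq_sin_maxAngle : projDist V W = Real.sin (maxAngle V W) := by
  rw [maxAngle_eq_arcsin_projDist, Real.sin_arcsin (by linarith [projDist_nonneg V W])
    (projDist_le_one V W)]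

theorem maxAngle_nonneg : 0 ≤ maxAngle V W := by
  rw [maxAngle_eq_arcsin_projDist]
  exact Real.arcsin_nonneg.2 (projDist_nonneg V W)

theorem maxAngle_le_pi_div_two : maxAngle V W ≤ Real.pi / 2 := by
  rw [maxAngle_eq_arcsin_projDist]
  exact Real.arcsin_le_pi_div_two _

theorem projDist_le_maxAngle : projDist V W ≤ maxAngle V W := by
  rw [projDist_eq_sin_maxAngle]
  exact Real.sin_le (maxAngle_nonneg V W)

theorem two_div_pi_mul_maxAngle_le_projDist : 2 / Real.pi * maxAngle V W ≤ projDist V W := by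
  rw [projDist_eq_sin_maxAngle]
  exact Real.mul_le_sin (maxAngle_nonneg V W) (maxAngle_le_pi_div_two V W)

theorem isCompatibleMetric_maxAngle :
    IsCompatibleMetric (maxAngle : Grassmannian s d → Grassmannian s d → ℝ) := by
  refine Grassmannian.isCompatibleMetric_projDist.of_le_mul (a := 1) (b := Real.pi / 2)
    (fun V W => ?_) (fun U V W => ?_) one_pos (by positivity) (fun V W => ?_) (fun V W => ?_)
  · rw [maxAngle_eq_arcsin_projDist, maxAngle_eq_arcsin_projDist, projDist_comm]
  · simp only [maxAngle_eq_arcsin_projDist]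
    exact arcsin_norm_starProjection_sub_triangle U.1 V.1 W.1
  · rw [one_mul]
    exact projDist_le_maxAngle V W
  · have := two_div_pi_mul_maxAngle_le_projDist V W
    rw [div_mul_eq_mul_div, div_le_iff₀ Real.pi_pos] at this
    linarith

end Topology

/-! ### Graph charts -/

section GraphCharts

section Graph

variable {d : ℕ} {P : Submodule ℝ (EuclideanSpace ℝ (Fin d))}

theorem mem_graphSubspace {X : P →ₗ[ℝ] Pᗮ} {z : EuclideanSpace ℝ (Fin d)} :
    z ∈ graphSubspace P X ↔ ∃ p : P, (p : EuclideanSpace ℝ (Fin d)) + X p = z :=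
  Iff.rfl

theorem orthogonalProjectionOnto_add_coe (p : P) (q : Pᗮ) :
    P.orthogonalProjectionOnto ((p : EuclideanSpace ℝ (Fin d)) + q) = p := by
  rw [map_add, Submodule.orthogonalProjectionOnto_mem_subspace_eq_self,
    Submodule.orthogonalProjectionOnto_eq_zero_iff.2 q.2, add_zero]

theorem coe_add_coe_inj {p p' : P} {q q' : Pᗮ}
    (h : (p : EuclideanSpace ℝ (Fin d)) + q = p' + q') : p = p' ∧ q = q' := by
  have hp : p = p' := by
    rw [← orthogonalProjectionOnto_add_coe p q, h, orthogonalProjectionOnto_add_coe]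
  subst hp
  exact ⟨rfl, Subtype.ext (add_left_cancel h)⟩

theorem finrank_graphSubspace (X : P →ₗ[ℝ] Pᗮ) :
    Module.finrank ℝ (graphSubspace P X) = Module.finrank ℝ P :=
  LinearMap.finrank_range_of_inj fun _ _ h => (coe_add_coe_inj h).1

theorem graphSubspace_injective : Function.Injective (graphSubspace P) := by
  intro X Y h
  ext1 p
  obtain ⟨p', hp'⟩ := mem_graphSubspace.1 (h ▸ mem_graphSubspace.2 ⟨p, rfl⟩ :
    (p : EuclideanSpace ℝ (Fin d)) + X p ∈ graphSubspace P Y)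
  obtain ⟨rfl, h'⟩ := coe_add_coe_inj hp'
  exact h'.symm

theorem isCompl_graphSubspace (X : P →ₗ[ℝ] Pᗮ) : IsCompl (graphSubspace P X) Pᗮ := by
  constructor
  · rw [Submodule.disjoint_def]
    rintro z hz hz'
    obtain ⟨p, rfl⟩ := mem_graphSubspace.1 hz
    have hp : p = 0 := by
      rw [← orthogonalProjectionOnto_add_coe p (X p),
        Submodule.orthogonalProjectionOnto_eq_zero_iff.2 hz']
    simp [hp]
  · rw [codisjoint_iff, Submodule.eq_top_iff']
    intro z
    have hz := P.starProjection_add_starProjection_orthogonal z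
    refine Submodule.mem_sup.2 ⟨_, mem_graphSubspace.2 ⟨P.orthogonalProjectionOnto z, rfl⟩,
      ((Pᗮ.orthogonalProjectionOnto z - X (P.orthogonalProjectionOnto z) : Pᗮ) :
        EuclideanSpace ℝ (Fin d)), Subtype.mem _, ?_⟩
    rw [Submodule.coe_sub, add_assoc, add_sub_cancel]
    exact hz

variable {F : Type*} [NormedAddCommGroup F] [NormedSpace ℝ F]

/-- The operator `P → Pᗮ` whose graph is the range of `L`. It is computed by inverting the
component of `L` in `P`; the value is meaningful only if that component is invertible. -/
noncomputable def graphCoord (P : Submodule ℝ (EuclideanSpace ℝ (Fin d)))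
    (L : F →L[ℝ] EuclideanSpace ℝ (Fin d)) : P →L[ℝ] Pᗮ :=
  (Pᗮ.orthogonalProjectionOnto ∘L L) ∘L (P.orthogonalProjectionOnto ∘L L).inverse

theorem graphSubspace_graphCoord {L : F →L[ℝ] EuclideanSpace ℝ (Fin d)}
    (hL : (P.orthogonalProjectionOnto ∘L L).IsInvertible) :
    graphSubspace P (graphCoord P L : P →ₗ[ℝ] Pᗮ) = L.range := by
  have key (x : F) : ((P.orthogonalProjectionOnto (L x) : P) : EuclideanSpace ℝ (Fin d)) +
      graphCoord P L (P.orthogonalProjectionOnto (L x)) = L x := by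
    have : graphCoord P L (P.orthogonalProjectionOnto (L x)) =
        Pᗮ.orthogonalProjectionOnto (L x) := by
      have h := hL.inverse_apply_self x
      simp only [graphCoord, ContinuousLinearMap.comp_apply] at h ⊢
      rw [h]
    rw [this]
    exact P.starProjection_add_starProjection_orthogonal (L x)
  apply le_antisymm
  · intro z hz
    obtain ⟨p, rfl⟩ := mem_graphSubspace.1 hz
    obtain ⟨x, rfl⟩ := hL.surjective p
    exact ⟨x, (key x).symm⟩
  · rintro _ ⟨x, rfl⟩
    exact mem_graphSubspace.2 ⟨_, key x⟩

theorem contDiffAt_graphCoord [CompleteSpace F] {L : F →L[ℝ] EuclideanSpace ℝ (Fin d)}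
    (hL : (P.orthogonalProjectionOnto ∘L L).IsInvertible) :
    ContDiffAt ℝ ∞ (graphCoord P : (F →L[ℝ] EuclideanSpace ℝ (Fin d)) → _) L := by
  have h (Q : Submodule ℝ (EuclideanSpace ℝ (Fin d))) : ContDiffAt ℝ ∞
      (fun L : F →L[ℝ] EuclideanSpace ℝ (Fin d) => Q.orthogonalProjectionOnto ∘L L) L :=
    contDiffAt_const.clm_comp contDiffAt_id
  exact (h Pᗮ).clm_comp (hL.contDiffAt_map_inverse.comp L (h P))

/-- The component in `P` of an injective map `L` is invertible if the range of `L` meets `Pᗮ`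
trivially and the dimensions agree. -/
theorem isInvertible_orthogonalProjectionOnto_comp [FiniteDimensional ℝ F]
    {L : F →L[ℝ] EuclideanSpace ℝ (Fin d)} (hinj : Function.Injective L)
    (hdisj : Disjoint L.range Pᗮ) (hF : Module.finrank ℝ F = Module.finrank ℝ P) :
    (P.orthogonalProjectionOnto ∘L L).IsInvertible := by
  have hi : Function.Injective (P.orthogonalProjectionOnto ∘L L : F →ₗ[ℝ] P) := by
    rw [injective_iff_map_eq_zero]
    intro x hx
    have h1 : L x ∈ Pᗮ := Submodule.orthogonalProjectionOnto_eq_zero_iff.1 hx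
    have h2 := (Submodule.disjoint_def.1 hdisj) (L x) ⟨x, rfl⟩ h1
    exact hinj (h2.trans (map_zero L).symm)
  refine ⟨(LinearEquiv.ofInjectiveOfFinrankEq _ hi hF).toContinuousLinearEquiv, ?_⟩
  ext x
  rfl

theorem graphSubspace_graphCoord_of_range_le {V : Submodule ℝ (EuclideanSpace ℝ (Fin d))}
    (hV : Module.finrank ℝ V = Module.finrank ℝ P) {L : F →L[ℝ] EuclideanSpace ℝ (Fin d)}
    (hL : (P.orthogonalProjectionOnto ∘L L).IsInvertible) (hrange : L.range ≤ V) :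
    graphSubspace P (graphCoord P L : P →ₗ[ℝ] Pᗮ) = V :=
  Submodule.eq_of_le_of_finrank_eq ((graphSubspace_graphCoord hL).le.trans hrange)
    ((finrank_graphSubspace _).trans hV.symm)

theorem range_starProjection_comp_le (V : Submodule ℝ (EuclideanSpace ℝ (Fin d)))
    (L : F →L[ℝ] EuclideanSpace ℝ (Fin d)) : (V.starProjection ∘L L).range ≤ V := by
  rintro _ ⟨x, rfl⟩
  exact V.starProjection_apply_mem _

/-- Complementarity of `V` to `Pᗮ`, expressed by the orthogonal projection onto `V`: in this form
it is an open condition, and it makes `graphCoord` applicable. -/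
theorem isCompl_orthogonal_iff {V : Submodule ℝ (EuclideanSpace ℝ (Fin d))}
    (hV : Module.finrank ℝ V = Module.finrank ℝ P) :
    IsCompl V Pᗮ ↔
      (P.orthogonalProjectionOnto ∘L (V.starProjection ∘L P.subtypeL)).IsInvertible := by
  have hrange := range_starProjection_comp_le V P.subtypeL
  constructor
  · intro h
    refine isInvertible_orthogonalProjectionOnto_comp ?_ (h.disjoint.mono_left hrange) rfl
    refine (injective_iff_map_eq_zero _).2 fun p hp => ?_
    have h1 : (p : EuclideanSpace ℝ (Fin d)) ∈ Vᗮ ⊓ Pᗮᗮ :=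
      ⟨V.starProjection_apply_eq_zero_iff.1 hp, P.le_orthogonal_orthogonal p.2⟩
    rw [Submodule.inf_orthogonal, h.sup_eq_top, Submodule.top_orthogonal_eq_bot] at h1
    exact Subtype.ext ((Submodule.mem_bot ℝ).1 h1)
  · intro h
    have := graphSubspace_graphCoord_of_range_le hV h hrange
    exact this ▸ isCompl_graphSubspace _

/-- The parametrization `p ↦ p + X p` of the graph of `X`. -/
noncomputable def graphMap (P : Submodule ℝ (EuclideanSpace ℝ (Fin d))) (X : P →L[ℝ] Pᗮ) :
    P →L[ℝ] EuclideanSpace ℝ (Fin d) :=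
  P.subtypeL + Pᗮ.subtypeL ∘L X

theorem range_graphMap (X : P →L[ℝ] Pᗮ) :
    (graphMap P X).range = graphSubspace P (X : P →ₗ[ℝ] Pᗮ) :=
  rfl

theorem contDiff_graphMap : ContDiff ℝ ∞ (graphMap P) :=
  contDiff_const.add (contDiff_const.clm_comp contDiff_id)

theorem isInvertible_orthogonalProjectionOnto_comp_graphMap
    {Q : Submodule ℝ (EuclideanSpace ℝ (Fin d))} (hQ : Module.finrank ℝ Q = Module.finrank ℝ P)
    {X : Q →L[ℝ] Qᗮ} (h : IsCompl (graphSubspace Q (X : Q →ₗ[ℝ] Qᗮ)) Pᗮ) :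
    (P.orthogonalProjectionOnto ∘L graphMap Q X).IsInvertible :=
  isInvertible_orthogonalProjectionOnto_comp
    (fun _ _ h => (coe_add_coe_inj h).1) (by rw [range_graphMap]; exact h.disjoint) hQ

/-- The graph depends on the operator in a nonexpanding way: the point `p + X p` of one graph has
the neighbour `p + Y p` on the other. -/
theorem norm_starProjection_graphSubspace_sub_le (X Y : P →L[ℝ] Pᗮ) :
    ‖(graphSubspace P (X : P →ₗ[ℝ] Pᗮ)).starProjection -
      (graphSubspace P (Y : P →ₗ[ℝ] Pᗮ)).starProjection‖ ≤ ‖X - Y‖ := by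
  have aux (X Y : P →L[ℝ] Pᗮ) : ∀ v ∈ graphSubspace P (X : P →ₗ[ℝ] Pᗮ),
      ‖v - (graphSubspace P (Y : P →ₗ[ℝ] Pᗮ)).starProjection v‖ ≤ ‖X - Y‖ * ‖v‖ := by
    intro v hv
    obtain ⟨p, rfl⟩ := mem_graphSubspace.1 hv
    have hp : ‖p‖ ≤ ‖(p : EuclideanSpace ℝ (Fin d)) + X p‖ := by
      have := P.norm_orthogonalProjectionOnto_apply_le ((p : EuclideanSpace ℝ (Fin d)) + X p)
      rwa [orthogonalProjectionOnto_add_coe] at this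
    calc _ ≤ ‖((p : EuclideanSpace ℝ (Fin d)) + X p) - (p + Y p)‖ :=
          norm_sub_starProjection_le _ (mem_graphSubspace.2 ⟨p, rfl⟩)
      _ = ‖(X - Y) p‖ := by
          rw [add_sub_add_left_eq_sub, ← Submodule.coe_sub]
          rfl
      _ ≤ ‖X - Y‖ * ‖p‖ := (X - Y).le_opNorm p
      _ ≤ _ := by gcongr; exact hp
  exact norm_starProjection_sub_le (norm_nonneg (X - Y)) (aux X Y)
    (norm_sub_rev X Y ▸ aux Y X)

end Graph

namespace Grassmannian

variable {s d : ℕ}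

theorem finrank_coord_eq_finrank_hom (P : Grassmannian s d) :
    Module.finrank ℝ (EuclideanSpace ℝ (Fin (s * (d - s)))) =
      Module.finrank ℝ (P.1 →L[ℝ] P.1ᗮ) := by
  have h := P.1.finrank_add_finrank_orthogonal
  rw [P.2, finrank_euclideanSpace_fin] at h
  have h' : d - s = Module.finrank ℝ P.1ᗮ := by omega
  rw [← (LinearMap.toContinuousLinearMap : (P.1 →ₗ[ℝ] P.1ᗮ) ≃ₗ[ℝ] _).finrank_eq,
    Module.finrank_linearMap, P.2, finrank_euclideanSpace_fin, h']

/-- Linear coordinates on `Hom(P, Pᗮ)`. -/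
noncomputable def homCoord (P : Grassmannian s d) :
    EuclideanSpace ℝ (Fin (s * (d - s))) ≃L[ℝ] (P.1 →L[ℝ] P.1ᗮ) :=
  ContinuousLinearEquiv.ofFinrankEq P.finrank_coord_eq_finrank_hom

/-- The inverse of the graph chart around `P`, before linear coordinates on `Hom(P, Pᗮ)` are
chosen: the graph of `X` as a point of the Grassmannian. -/
noncomputable def ofGraph (P : Grassmannian s d) (X : P.1 →L[ℝ] P.1ᗮ) : Grassmannian s d :=
  ⟨graphSubspace P.1 (X : P.1 →ₗ[ℝ] P.1ᗮ), (finrank_graphSubspace _).trans P.2⟩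

/-- The operator `P → Pᗮ` with graph `V`, computed from the parametrization of `V` by its orthogonal
projection restricted to `P`. The value is meaningful only if `V` is complementary to `Pᗮ`. -/
noncomputable def toGraph (P V : Grassmannian s d) : P.1 →L[ℝ] P.1ᗮ :=
  graphCoord P.1 (V.toProjection ∘L P.1.subtypeL)

theorem ofGraph_toGraph {P V : Grassmannian s d} (h : IsCompl V.1 P.1ᗮ) :
    P.ofGraph (P.toGraph V) = V :=
  Subtype.ext (graphSubspace_graphCoord_of_range_le (V.2.trans P.2.symm)
    ((isCompl_orthogonal_iff (V.2.trans P.2.symm)).1 h) (range_starProjection_comp_le _ _))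

theorem toGraph_eq {P V : Grassmannian s d} {X : P.1 →L[ℝ] P.1ᗮ} (h : V = P.ofGraph X) :
    P.toGraph V = X := by
  subst h
  have := ofGraph_toGraph (P := P) (V := P.ofGraph X) (isCompl_graphSubspace _)
  exact ContinuousLinearMap.coe_injective (graphSubspace_injective (congrArg Subtype.val this))

theorem continuous_ofGraph (P : Grassmannian s d) : Continuous P.ofGraph := by
  rw [isClosedEmbedding_toProjection.isEmbedding.continuous_iff]
  have h : LipschitzWith 1 (toProjection ∘ P.ofGraph) := LipschitzWith.of_dist_le_mul fun X Y => by
    rw [dist_eq_norm, dist_eq_norm, NNReal.coe_one, one_mul]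
    exact norm_starProjection_graphSubspace_sub_le X Y
  exact h.continuous

theorem isCompl_iff_isInvertible (P V : Grassmannian s d) : IsCompl V.1 P.1ᗮ ↔
    (P.1.orthogonalProjectionOnto ∘L (V.toProjection ∘L P.1.subtypeL)).IsInvertible :=
  isCompl_orthogonal_iff (V.2.trans P.2.symm)

theorem isOpen_isCompl (P : Grassmannian s d) :
    IsOpen {V : Grassmannian s d | IsCompl V.1 P.1ᗮ} := by
  simp only [isCompl_iff_isInvertible]
  have hcont : Continuous fun V : Grassmannian s d =>
      P.1.orthogonalProjectionOnto ∘L (V.toProjection ∘L P.1.subtypeL) :=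
    continuous_const.clm_comp (continuous_toProjection.clm_comp continuous_const)
  exact (ContinuousLinearEquiv.isOpen (𝕜 := ℝ) (E := P.1) (F := P.1)).preimage hcont

theorem continuousAt_toGraph {P V : Grassmannian s d} (h : IsCompl V.1 P.1ᗮ) :
    ContinuousAt P.toGraph V := by
  have hcont : Continuous fun V : Grassmannian s d => V.toProjection ∘L P.1.subtypeL :=
    continuous_toProjection.clm_comp continuous_const
  exact ContinuousAt.comp (f := fun V : Grassmannian s d => V.toProjection ∘L P.1.subtypeL)
    (contDiffAt_graphCoord ((isCompl_iff_isInvertible P V).1 h)).continuousAt hcont.continuousAt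

/-- In graph coordinates, the change of charts is `X ↦ graphCoord Q (graphMap P X)`. -/
theorem toGraph_ofGraph {P Q : Grassmannian s d} {X : P.1 →L[ℝ] P.1ᗮ}
    (h : IsCompl (P.ofGraph X).1 Q.1ᗮ) :
    Q.toGraph (P.ofGraph X) = graphCoord Q.1 (graphMap P.1 X) :=
  toGraph_eq <| Subtype.ext <| ((graphSubspace_graphCoord
    (isInvertible_orthogonalProjectionOnto_comp_graphMap (P.2.trans Q.2.symm) h)).trans
      (range_graphMap X)).symm

theorem contDiffAt_toGraph_ofGraph {P Q : Grassmannian s d} {X : P.1 →L[ℝ] P.1ᗮ}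
    (h : IsCompl (P.ofGraph X).1 Q.1ᗮ) :
    ContDiffAt ℝ ∞ (fun X => Q.toGraph (P.ofGraph X)) X := by
  refine ContDiffAt.congr_of_eventuallyEq (f := fun X => graphCoord Q.1 (graphMap P.1 X)) ?_ ?_
  · exact (contDiffAt_graphCoord (isInvertible_orthogonalProjectionOnto_comp_graphMap
      (P.2.trans Q.2.symm) h)).comp X contDiff_graphMap.contDiffAt
  · filter_upwards [(Q.isOpen_isCompl.preimage P.continuous_ofGraph).mem_nhds h] with Y hY
    exact toGraph_ofGraph hY

/-- The graph chart around `P`. -/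
noncomputable def graphChart (P : Grassmannian s d) :
    OpenPartialHomeomorph (Grassmannian s d) (EuclideanSpace ℝ (Fin (s * (d - s)))) where
  toFun V := P.homCoord.symm (P.toGraph V)
  invFun x := P.ofGraph (P.homCoord x)
  source := {V | IsCompl V.1 P.1ᗮ}
  target := Set.univ
  map_source' _ _ := Set.mem_univ _
  map_target' _ _ := isCompl_graphSubspace _
  left_inv' V hV := by
    rw [ContinuousLinearEquiv.apply_symm_apply, ofGraph_toGraph hV]
  right_inv' x _ := by
    rw [toGraph_eq rfl, ContinuousLinearEquiv.symm_apply_apply]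
  continuousOn_toFun V hV :=
    (P.homCoord.symm.continuous.continuousAt.comp (continuousAt_toGraph hV)).continuousWithinAt
  continuousOn_invFun := (P.continuous_ofGraph.comp P.homCoord.continuous).continuousOn
  open_source := P.isOpen_isCompl
  open_target := isOpen_univ

theorem isGraphChart_graphChart (P : Grassmannian s d) : IsGraphChart P P.graphChart :=
  ⟨rfl, rfl, P.homCoord.toLinearEquiv ≪≫ₗ LinearMap.toContinuousLinearMap.symm, fun _ => rfl⟩

noncomputable instance : ChartedSpace (EuclideanSpace ℝ (Fin (s * (d - s)))) (Grassmannian s d) where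
  atlas := Set.range graphChart
  chartAt := graphChart
  mem_chart_source P := P.1.isCompl_orthogonal
  chart_mem_atlas P := ⟨P, rfl⟩

instance : IsManifold (𝓡 (s * (d - s))) ∞ (Grassmannian s d) := by
  refine isManifold_of_contDiffOn _ _ _ ?_
  rintro _ _ ⟨P, rfl⟩ ⟨Q, rfl⟩ x ⟨hx, -⟩
  have hx' : IsCompl (P.ofGraph (P.homCoord x)).1 Q.1ᗮ := hx.2
  have hP : ContDiff ℝ ∞ P.homCoord := by fun_prop
  have hQ : ContDiff ℝ ∞ Q.homCoord.symm := by fun_prop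
  exact (hQ.contDiffAt.comp x
    ((contDiffAt_toGraph_ofGraph hx').comp x hP.contDiffAt)).contDiffWithinAt

end Grassmannian

end GraphCharts

/-! ### The Grassmannian as a manifold and as a metric space -/

theorem mainTheorem4 (s d : ℕ) (hsd : s ≤ d) :
    -- the Grassmannian is compact, Hausdorff and second countable
    (CompactSpace (Grassmannian s d) ∧ T2Space (Grassmannian s d) ∧
      SecondCountableTopology (Grassmannian s d)) ∧
    -- with its standard (graph) charts it is a smooth manifold of dimension `s (d - s)`
    (∃ _ : ChartedSpace (EuclideanSpace ℝ (Fin (s * (d - s)))) (Grassmannian s d),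
      IsManifold (𝓡 (s * (d - s))) ∞ (Grassmannian s d) ∧
      ∀ P : Grassmannian s d,
        IsGraphChart P (chartAt (EuclideanSpace ℝ (Fin (s * (d - s)))) P)) ∧
    -- principal angles exist, and the last one is well defined
    (∀ V W : Grassmannian s d,
      (∃ (φ : Fin s → ℝ) (v w : Fin s → EuclideanSpace ℝ (Fin d)),
        IsPrincipalSystem V.1 W.1 φ v w) ∧
      ∀ (φ : Fin s → ℝ) (v w : Fin s → EuclideanSpace ℝ (Fin d)),
        IsPrincipalSystem V.1 W.1 φ v w → ∀ j : Fin s, (j : ℕ) + 1 = s → maxAngle V W = φ j) ∧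
    -- both distances are metrics (inducing the topology of the manifold)
    IsCompatibleMetric (maxAngle : Grassmannian s d → Grassmannian s d → ℝ) ∧
    IsCompatibleMetric (projDist : Grassmannian s d → Grassmannian s d → ℝ) ∧
    -- they are equivalent, and related as follows
    (∀ V W : Grassmannian s d,
      projDist V W = Real.sin (maxAngle V W) ∧
      2 / Real.pi * maxAngle V W ≤ projDist V W ∧
      projDist V W ≤ maxAngle V W) := by
  refine ⟨⟨inferInstance, inferInstance, inferInstance⟩,
    ⟨inferInstance, inferInstance, Grassmannian.isGraphChart_graphChart⟩,
    fun V W => ⟨exists_isPrincipalSystem V.2 W.2, fun φ v w h j hj => ?_⟩,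
    isCompatibleMetric_maxAngle, Grassmannian.isCompatibleMetric_projDist,
    fun V W => ⟨projDist_eq_sin_maxAngle V W, two_div_pi_mul_maxAngle_le_projDist V W,
      projDist_le_maxAngle V W⟩⟩
  rw [maxAngle_eq_arcsin_projDist]
  exact (h.eq_arcsin V.2 W.2 fun i => Fin.le_def.2 (by omega)).symm
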